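/- There are universal constants $c,c_1,C>0$ such that the following holds. Let $n>1$ be an integer, $\mu>\lambda>0$ and $\epsilon\in(0,c)$. There is a dimension $$d\le C\Big(1+\sqrt{\tfrac{\mu}{\lambda n}}\Big)\log\Big(\frac{n\mu}{\lambda\epsilon}\Big)$$ such that for every (possibly randomized) algorithm on $\mathbb R^d$ which satisfies assumptions (1) and (2) below, there are quadratic functions $f_1,\dots,f_n:\mathbb R^d\to\mathbb R$, each of them $\mu$-smooth and $\lambda$-strongly convex ($\lambda I\preceq\nabla^2 f_i\preceq\mu I$), whose average $F=\frac1n\sum_{i=1}^n f_i$ attains its minimum and has the following property: if, for some $T\ge 1$, the $T$-th iterate $w_T$ of the algorithm on $f_1,\dots,f_n$ satisfies $$\mathbb E\big[F(w_T)-\min F\big]\le\epsilon\,\big(F(0)-\min F\big),$$ then $$T\ \ge\ c_1\Big(n+\sqrt{n\big(\tfrac{\mu}{\lambda}-1\big)}\,\log\Big(\frac{(\lambda/\mu)^{3/2}\sqrt n}{\epsilon}\Big)\Big),$$ and, if moreover $\mu\ge 2\lambda$, also $$T\ \ge\ c_1\Big(n+\sqrt{\tfrac{n\mu}{\lambda}}\,\log\Big(\frac{(\lambda/\mu)^{3/2}\sqrt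 n}{\epsilon}\Big)\Big).$$ Here an algorithm produces queries $(w_1,i_1),(w_2,i_2),\dots$ with $w_t\in\mathbb R^d$ and $i_t\in\{1,\dots,n\}$, each of which is a function of a random seed and of the oracle's answers to the previous queries. The answer to $(w_t,i_t)$ consists of $f_{i_t}(w_t)$, $\nabla f_{i_t}(w_t)$ and $\nabla^2 f_{i_t}(w_t)$ (second-order oracle); the result holds, with the same constants, the same dimension $d$ and the same bounds, for an oracle which returns the value and the derivatives of all orders up to $p$, for any $p\in\{0,1,2,\dots,\infty\}$. The assumptions on the algorithm are, for all $n$-tuples of $\mu$-smooth, $\lambda$-strongly convex quadratics $f_1,\dots,f_n$ on $\mathbb R^d$: (1) (Linear-algebraic computations.) Almost surely, $w_t\in\mathcal W_t$ for all $t$, where $\mathcal W_1=\{0\}$ and $\mathcal W_{t+1}$ is the closure of the set of vectors derived from $\mathcal W_t\cup\{\nabla f_{i_t}(w_t)\}$ by finitely many operations of the form $(w,w')\mapsto\alpha w+\alpha' w'$ with scalars $\alpha,\alpha'$, or $w\mapsto Hw$, where $H$ is a $d\times d$ matrix with the same block-diagonal structure as $\sum_{\tau=\max\{1,t-\lfloor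 n/2\rfloor+1\}}^{t}\alpha_\tau\nabla^2 f_{i_\tau}(w_\tau)$ for some scalars $\alpha_\tau$; that is, every decomposition of the latter matrix into consecutive diagonal blocks is also one of $H$. (2) (Index obliviousness.) The indices $i_1,i_2,\dots$ are independent of $f_1,\dots,f_n$: their joint law is the same for all such $f_1,\dots,f_n$. -/

import Mathlib

open MeasureTheory

/-- The Euclidean space `ℝ^d`. -/
abbrev Vec (d : ℕ) : Type := EuclideanSpace ℝ (Fin d)

/-- The Hessian matrix of `f` at `w`, i.e. the matrix of second partial derivatives. -/
noncomputable def hessianMatrix {d : ℕ} (f : Vec d → ℝ) (w : Vec d) :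
    Matrix (Fin d) (Fin d) ℝ :=
  Matrix.of fun r s =>
    iteratedFDeriv ℝ 2 f w ![EuclideanSpace.single r (1 : ℝ), EuclideanSpace.single s (1 : ℝ)]

/-- `f` is a quadratic function (a polynomial function of degree at most two). -/
def IsQuadratic {d : ℕ} (f : Vec d → ℝ) : Prop :=
  ∃ (A : Matrix (Fin d) (Fin d) ℝ) (b : Fin d → ℝ) (c : ℝ), ∀ w : Vec d,
    f w = (1 / 2) * ∑ r, ∑ s, A r s * w r * w s + ∑ r, b r * w r + c

/-- A twice continuously differentiable `f` is `mu`-smooth and `lam`-strongly convex: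
`lam I ≼ ∇² f(w) ≼ mu I` for all `w`. -/
def IsSmoothStronglyConvex {d : ℕ} (lam mu : ℝ) (f : Vec d → ℝ) : Prop :=
  ContDiff ℝ 2 f ∧ ∀ w v : Vec d,
    lam * ‖v‖ ^ 2 ≤ iteratedFDeriv ℝ 2 f w ![v, v] ∧
      iteratedFDeriv ℝ 2 f w ![v, v] ≤ mu * ‖v‖ ^ 2

/-- The problem instances: `n`-tuples of `mu`-smooth, `lam`-strongly convex quadratics on `ℝ^d`. -/
def quadraticInstances (n d : ℕ) (lam mu : ℝ) : Set (Fin n → Vec d → ℝ) :=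
  {f | ∀ i, IsQuadratic (f i) ∧ IsSmoothStronglyConvex lam mu (f i)}

/-- The objective `F(w) = (1/n) ∑ᵢ fᵢ(w)`. -/
noncomputable def meanObjective {n d : ℕ} (f : Fin n → Vec d → ℝ) (w : Vec d) : ℝ :=
  (1 / (n : ℝ)) * ∑ i, f i w

/-! ### Oracles and algorithms -/

/-- An answer of an oracle of order `p`: a value and the derivatives of every order `k ≤ p`
(order `0` being the value). A second-order oracle is the case `p = 2`; `p = ⊤` is the oracle
which returns the derivatives of all orders. -/
abbrev OracleAnswer (d : ℕ) (p : ℕ∞) : Type :=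
  (k : {k : ℕ // (k : ℕ∞) ≤ p}) → ContinuousMultilinearMap ℝ (fun _ : Fin (k : ℕ) => Vec d) ℝ

/-- The oracle of order `p`: given an index `i` and a point `w`, it returns
`fᵢ(w), D fᵢ(w), D² fᵢ(w), …` up to order `p`. -/
noncomputable def oracle {n d : ℕ} (p : ℕ∞) (f : Fin n → Vec d → ℝ) (i : Fin n) (w : Vec d) :
    OracleAnswer d p :=
  fun k => iteratedFDeriv ℝ (k : ℕ) (f i) w

/-- A randomized algorithm with random seed in `Ω`: the next query (a point and an index) is
determined by the seed and by the list of the answers which the oracle has given so far. -/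
structure Algorithm (Ω : Type*) (n d : ℕ) (p : ℕ∞) where
  point : Ω → List (OracleAnswer d p) → Vec d
  index : Ω → List (OracleAnswer d p) → Fin n

namespace Algorithm

variable {Ω : Type*} {n d : ℕ} {p : ℕ∞}

/-- The answers to the first `t` queries when the algorithm is run on `f`. -/
noncomputable def answers (alg : Algorithm Ω n d p) (f : Fin n → Vec d → ℝ) (ω : Ω) :
    ℕ → List (OracleAnswer d p)
  | 0 => []
  | t + 1 => alg.answers f ω t ++
      [oracle p f (alg.index ω (alg.answers f ω t)) (alg.point ω (alg.answers f ω t))]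

/-- The point of the query number `t + 1` (so `iterate f ω 0` is the first iterate). -/
noncomputable def iterate (alg : Algorithm Ω n d p) (f : Fin n → Vec d → ℝ) (ω : Ω) (t : ℕ) :
    Vec d :=
  alg.point ω (alg.answers f ω t)

/-- The index of the query number `t + 1`. -/
noncomputable def queried (alg : Algorithm Ω n d p) (f : Fin n → Vec d → ℝ) (ω : Ω) (t : ℕ) :
    Fin n :=
  alg.index ω (alg.answers f ω t)

end Algorithm

/-! ### The points which linear-algebraic computations can reach -/

/-- `M` is block-diagonal with respect to the consecutive blocks of coordinates which are the
level sets of the monotone labelling `b` of the coordinates. -/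
def IsBlockDiagonal {d : ℕ} (b : Fin d → ℕ) (M : Matrix (Fin d) (Fin d) ℝ) : Prop :=
  ∀ r s, b r ≠ b s → M r s = 0

/-- `H` has the same block-diagonal structure as `M`: every decomposition of `M` into consecutive
diagonal blocks is one of `H` as well (`H` may be decomposable further). -/
def SameBlockStructure {d : ℕ} (M H : Matrix (Fin d) (Fin d) ℝ) : Prop :=
  ∀ b : Fin d → ℕ, Monotone b → IsBlockDiagonal b M → IsBlockDiagonal b H

/-- The vectors obtained from vectors of `S` by finitely many operations: linear combinations of
two vectors, and multiplications by matrices in `𝓗`. -/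
inductive Derived {d : ℕ} (S : Set (Vec d)) (𝓗 : Set (Matrix (Fin d) (Fin d) ℝ)) : Vec d → Prop
  | base (w : Vec d) (hw : w ∈ S) : Derived S 𝓗 w
  | comb (α α' : ℝ) (w w' : Vec d) (hw : Derived S 𝓗 w) (hw' : Derived S 𝓗 w') :
      Derived S 𝓗 (α • w + α' • w')
  | mul (H : Matrix (Fin d) (Fin d) ℝ) (hH : H ∈ 𝓗) (w : Vec d) (hw : Derived S 𝓗 w) :
      Derived S 𝓗 (WithLp.toLp 2 (H.mulVec w.ofLp))

/-- The matrices with which one may multiply after the query at time `t` (times are counted from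
`0` here): those with the same block-diagonal structure as some linear combination of the Hessians
of the last (at most) `⌊n/2⌋` queries. -/
def allowedMatrices {n d : ℕ} (f : Fin n → Vec d → ℝ) (w : ℕ → Vec d) (i : ℕ → Fin n) (t : ℕ) :
    Set (Matrix (Fin d) (Fin d) ℝ) :=
  {H | ∃ α : ℕ → ℝ, SameBlockStructure
    (∑ τ ∈ (Finset.range (t + 1)).filter (fun τ => t < τ + n / 2),
      α τ • hessianMatrix (f (i τ)) (w τ)) H}

/-- The set in which the iterate at time `t` (counted from `0`) must lie, given the queries
`(w 0, i 0), …, (w (t - 1), i (t - 1))`. -/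
noncomputable def reachable {n d : ℕ} (f : Fin n → Vec d → ℝ) (w : ℕ → Vec d) (i : ℕ → Fin n) :
    ℕ → Set (Vec d)
  | 0 => {0}
  | t + 1 => closure
      {v | Derived (reachable f w i t ∪ {gradient (f (i t)) (w t)}) (allowedMatrices f w i t) v}

/-! ### Assumptions on algorithms -/

namespace Algorithm

variable {Ω : Type*} [MeasurableSpace Ω] {n d : ℕ} {p : ℕ∞}

/-- On every instance of the class, the queried points and indices are random variables. -/
def IsMeasurable (alg : Algorithm Ω n d p) (𝓕 : Set (Fin n → Vec d → ℝ)) : Prop :=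
  ∀ f ∈ 𝓕, ∀ t, Measurable (fun ω => alg.iterate f ω t) ∧ Measurable (fun ω => alg.queried f ω t)

/-- Linear-algebraic computations: on every instance of the class, almost surely, each iterate
lies in the set that is reachable from the previous queries. -/
def IsLinearAlgebraic (alg : Algorithm Ω n d p) (P : Measure Ω) (𝓕 : Set (Fin n → Vec d → ℝ)) :
    Prop :=
  ∀ f ∈ 𝓕, ∀ᵐ ω ∂P, ∀ t,
    alg.iterate f ω t ∈ reachable f (alg.iterate f ω) (alg.queried f ω) t

/-- Index obliviousness: the random sequence of the queried indices is independent of the instance,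
i.e. it has the same law on all instances of the class. -/
def IsOblivious (alg : Algorithm Ω n d p) (P : Measure Ω) (𝓕 : Set (Fin n → Vec d → ℝ)) : Prop :=
  ∀ f ∈ 𝓕, ∀ g ∈ 𝓕,
    P.map (fun ω t => alg.queried f ω t) = P.map (fun ω t => alg.queried g ω t)

end Algorithm

/-!
The hard instance is a chain split at random among the `fᵢ`. Put `a = (μ - λ) / 8`, and let each
link `l` of the chain `w₀, …, w_K` carry a label `j l`, with
`fᵢ(w) = λ/2 ‖w‖² + a ∑_{j l = i} (w_l - w_{l-1})² + (a (1 - q) / n) w_K²`, where `w₋₁ = 1`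
(constants are dropped). The mean `F` does not depend on the labels. For the `q` which solves
`n λ q = 2 a (1 - q)²` its minimizer is exactly `w_l = q ^ (l + 1)`: the end term makes the finite
chain behave like the infinite one (`chain_stationary`).

An algorithm that has reached the first `m` coordinates obtains the next one only when the label
`j m` is among its last `⌊n/2⌋` indices (`Passes`, `reachable_chainInstance`). If the labels are
uniform and independent, at least half of the labels are outside this window, and later queries
exclude at most one label each. Counting labellings, the probability of passing `d` links within
`T` queries is at most `(3/4) ^ d (1 + 4/n) ^ T` (`card_passes_le`). By obliviousness the law of
the indices is the same for all labellings, so averaging gives one labelling for which the last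
coordinate is still untouched with probability at least `1/2` (`exists_label_prob_le`). On that
event strong convexity leaves `F(w) - min F ≥ (λ/2) q ^ (2K+2)`, which is
`q ^ (2K) (1 - q)² (F(0) - min F)`.

With `x = √(n / (κ - 1))`, `κ = μ / λ`, one has `q = exp (-2 arsinh x) ≥ exp (-2x)`. When the
logarithm `L` in the bound is at least `128 x`, the choice `K ≈ L / (16 x)`, `T ≈ n L / (512 x)`
works (`card_bound_of_large`, `accuracy_of_large`). Otherwise the bound is of order `n`, and
dimension one suffices: before the label of its only link is queried, the iterate is `0`.
-/

/-! ### Quadratic functions -/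

/-- The quadratic function `w ↦ ½ wᵀ A w + bᵀ w`. -/
noncomputable def quadFun {d : ℕ} (A : Matrix (Fin d) (Fin d) ℝ) (b : Fin d → ℝ) (w : Vec d) : ℝ :=
  (1 / 2) * ∑ r, ∑ s, A r s * w r * w s + ∑ r, b r * w r

section quad
variable {d : ℕ} {A : Matrix (Fin d) (Fin d) ℝ}

theorem quadFun_sub (hA : A.IsSymm) (b : Fin d → ℝ) (w v : Vec d) :
    quadFun A b w - quadFun A b v =
      (1 / 2) * ∑ r, ∑ s, A r s * (w r - v r) * (w s - v s)
        + ∑ r, (∑ s, A r s * v s + b r) * (w r - v r) := by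
  have hswap : ∑ r, ∑ s, A r s * v r * w s = ∑ r, ∑ s, A r s * w r * v s := by
    rw [Finset.sum_comm]
    refine Finset.sum_congr rfl fun r _ => Finset.sum_congr rfl fun s _ => ?_
    rw [hA.apply r s]; ring
  have h1 : ∑ r, ∑ s, A r s * (w r - v r) * (w s - v s)
      = ∑ r, ∑ s, A r s * w r * w s - ∑ r, ∑ s, A r s * w r * v s
        - ∑ r, ∑ s, A r s * v r * w s + ∑ r, ∑ s, A r s * v r * v s := by
    simp only [← Finset.sum_sub_distrib, ← Finset.sum_add_distrib]
    refine Finset.sum_congr rfl fun r _ => Finset.sum_congr rfl fun s _ => ?_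
    ring
  have h2 : ∑ r, (∑ s, A r s * v s + b r) * (w r - v r)
      = ∑ r, ∑ s, A r s * w r * v s - ∑ r, ∑ s, A r s * v r * v s
        + (∑ r, b r * w r - ∑ r, b r * v r) := by
    simp only [← Finset.sum_sub_distrib, ← Finset.sum_add_distrib]
    refine Finset.sum_congr rfl fun r _ => ?_
    rw [add_mul, Finset.sum_mul, mul_sub]
    congr 1
    exact Finset.sum_congr rfl fun s _ => by ring
  rw [h1, h2, hswap]
  unfold quadFun
  ring

theorem hasFDerivAt_quadFun (hA : A.IsSymm) (b : Fin d → ℝ) (w : Vec d) :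
    HasFDerivAt (quadFun A b)
      (∑ r, (∑ s, A r s * w s + b r) • (EuclideanSpace.proj r : Vec d →L[ℝ] ℝ)) w := by
  have hp : ∀ r : Fin d, HasFDerivAt (fun w : Vec d => w r)
      (EuclideanSpace.proj r : Vec d →L[ℝ] ℝ) w := fun r =>
    (EuclideanSpace.proj r : Vec d →L[ℝ] ℝ).hasFDerivAt
  have h := ((HasFDerivAt.fun_sum fun r (_ : r ∈ Finset.univ) =>
    HasFDerivAt.fun_sum fun s (_ : s ∈ Finset.univ) =>
      ((hp r).const_mul (A r s)).mul (hp s)).const_mul (1 / 2 : ℝ)).add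
    (HasFDerivAt.fun_sum fun r (_ : r ∈ Finset.univ) => (hp r).const_mul (b r))
  refine HasFDerivAt.congr_fderiv h ?_
  ext v
  have hswap : ∑ r, ∑ s, A r s * w r * v s = ∑ r, ∑ s, A r s * w s * v r := by
    rw [Finset.sum_comm]
    refine Finset.sum_congr rfl fun r _ => Finset.sum_congr rfl fun s _ => ?_
    rw [hA.apply r s]
  have hswap' : ∑ r, ∑ s, w s * (A r s * v r) = ∑ r, ∑ s, A r s * w s * v r :=
    Finset.sum_congr rfl fun r _ => Finset.sum_congr rfl fun s _ => by ring
  simp [Finset.sum_add_distrib, add_mul, Finset.sum_mul, hswap, hswap']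
  ring

theorem gradient_quadFun (hA : A.IsSymm) (b : Fin d → ℝ) (w : Vec d) (r : Fin d) :
    gradient (quadFun A b) w r = ∑ s, A r s * w s + b r := by
  have h : HasGradientAt (quadFun A b) (WithLp.toLp 2 fun r => ∑ s, A r s * w s + b r) w := by
    rw [hasGradientAt_iff_hasFDerivAt]
    refine (hasFDerivAt_quadFun hA b w).congr_fderiv ?_
    ext v
    simp [PiLp.inner_apply, mul_comm]
  rw [h.gradient]

theorem iteratedFDeriv_two_quadFun (hA : A.IsSymm) (b : Fin d → ℝ) (w u v : Vec d) :
    iteratedFDeriv ℝ 2 (quadFun A b) w ![u, v] = ∑ r, ∑ s, A r s * u r * v s := by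
  have hp : ∀ r : Fin d, HasFDerivAt (fun w : Vec d => w r)
      (EuclideanSpace.proj r : Vec d →L[ℝ] ℝ) w := fun r =>
    (EuclideanSpace.proj r : Vec d →L[ℝ] ℝ).hasFDerivAt
  have h := HasFDerivAt.fun_sum fun r (_ : r ∈ Finset.univ) =>
    ((HasFDerivAt.fun_sum fun s (_ : s ∈ Finset.univ) =>
      (hp s).const_mul (A r s)).add_const (b r)).smul_const
        (EuclideanSpace.proj r : Vec d →L[ℝ] ℝ)
  rw [iteratedFDeriv_two_apply, funext fun w => (hasFDerivAt_quadFun hA b w).fderiv, h.fderiv]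
  simp [Finset.sum_mul]
  rw [Finset.sum_comm]
  refine Finset.sum_congr rfl fun r _ => Finset.sum_congr rfl fun s _ => ?_
  rw [hA.apply r s]

theorem hessianMatrix_quadFun (hA : A.IsSymm) (b : Fin d → ℝ) (w : Vec d) :
    hessianMatrix (quadFun A b) w = A := by
  ext r s
  simp only [hessianMatrix, Matrix.of_apply, iteratedFDeriv_two_quadFun hA]
  simp

theorem contDiff_quadFun (b : Fin d → ℝ) : ContDiff ℝ 2 (quadFun A b) := by
  unfold quadFun
  fun_prop

theorem isQuadratic_quadFun (b : Fin d → ℝ) : IsQuadratic (quadFun A b) :=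
  ⟨A, b, 0, fun w => by simp [quadFun]⟩

end quad

/-! ### Passing the links of a randomly labelled chain -/

/-- `Passes i j m t`: in the course of the queries `0, …, t - 1`, with indices `i`, the first `m`
links of a chain with labels `j` are passed one after the other. Link `m` can be passed at query
`s` if the first `m` links are already passed then (possibly at the same query) and the label of
link `m` is among the indices of the last `⌊n/2⌋` queries, query `s` included. -/
def Passes {n d : ℕ} (i : ℕ → Fin n) (j : Fin d → Fin n) : ℕ → ℕ → Prop
  | 0, _ => True
  | m + 1, t => ∃ s < t, Passes i j m (s + 1) ∧
      ∃ h : m < d, ∃ τ ≤ s, s < τ + n / 2 ∧ i τ = j ⟨m, h⟩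

section passes
variable {n d : ℕ} {i : ℕ → Fin n} {j : Fin d → Fin n}

theorem Passes.mono {m t t' : ℕ} (h : Passes i j m t) (ht : t ≤ t') : Passes i j m t' := by
  cases m with
  | zero => trivial
  | succ m =>
    obtain ⟨s, hs, h⟩ := h
    exact ⟨s, hs.trans_le ht, h⟩

theorem Passes.pred {m t : ℕ} (h : Passes i j (m + 1) t) : Passes i j m t := by
  obtain ⟨s, hs, h, -⟩ := h
  exact h.mono hs

theorem Passes.antitone {m m' t : ℕ} (h : Passes i j m t) (hm : m' ≤ m) : Passes i j m' t := by
  induction hm with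
  | refl => exact h
  | step _ ih => exact ih h.pred

theorem Passes.step {m t : ℕ} (hm : m < d) (h : Passes i j m (t + 1)) {τ : ℕ} (hτ : τ ≤ t)
    (hτ' : t < τ + n / 2) (hi : i τ = j ⟨m, hm⟩) : Passes i j (m + 1) (t + 1) :=
  ⟨t, t.lt_succ_self, h, hm, τ, hτ, hτ', hi⟩

theorem measurable_passes (j : Fin d → Fin n) (m t : ℕ) :
    Measurable fun i : ℕ → Fin n => Passes i j m t := by
  induction m generalizing t with
  | zero => exact measurable_const
  | succ m ih =>
    refine Measurable.exists fun s => measurable_const.and ((ih _).and (Measurable.exists fun h =>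
      Measurable.exists fun τ => measurable_const.and (measurable_const.and ?_)))
    exact measurableSet_setOfPred.mp (measurableSet_eq_fun (measurable_pi_apply τ) measurable_const)

/-- Passing the first `m ≤ d` links does not involve the label of link `d`. -/
theorem passes_snoc (j : Fin d → Fin n) (k : Fin n) {m : ℕ} (hm : m ≤ d) (t : ℕ) :
    Passes i (Fin.snoc j k : Fin (d + 1) → Fin n) m t ↔ Passes i j m t := by
  induction m generalizing t with
  | zero => exact Iff.rfl
  | succ m ih =>
    have hmd : m < d := hm
    have hk : (Fin.snoc j k : Fin (d + 1) → Fin n) ⟨m, hmd.trans d.lt_succ_self⟩ = j ⟨m, hmd⟩ :=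
      Fin.snoc_castSucc (α := fun _ => Fin n) k j ⟨m, hmd⟩
    simp only [Passes, ih hmd.le]
    simp only [hk, hmd, hmd.trans d.lt_succ_self, exists_true_left]

open Classical in
/-- For given labels of the first `d` links, the labels of link `d` which allow it to be passed
are those in the window at the first time when `d` links are passed, and the later indices. -/
theorem card_next_label_le (i : ℕ → Fin n) (j : Fin d → Fin n) (t : ℕ) :
    (Finset.univ.filter fun k : Fin n =>
        Passes i (Fin.snoc j k : Fin (d + 1) → Fin n) (d + 1) t).card
      ≤ (if Passes i j d t then n / 2 else 0)
        + ((Finset.range t).filter fun s => Passes i j d s).card := by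
  by_cases hP : ∃ s, s < t ∧ Passes i j d (s + 1)
  swap
  · rw [Finset.filter_false_of_mem]
    · simp
    · rintro k - ⟨s, hs, h, -⟩
      exact hP ⟨s, hs, (passes_snoc j k le_rfl _).1 h⟩
  -- `s₀` is the query at which the first `d` links become passed.
  have hs0 := Nat.find_spec hP
  have hmin : ∀ s, s < t ∧ Passes i j d (s + 1) → Nat.find hP ≤ s := fun s hs => Nat.find_min' hP hs
  generalize Nat.find hP = s₀ at hs0 hmin
  rw [if_pos (hs0.2.mono hs0.1)]
  have hsub : (Finset.univ.filter fun k : Fin n =>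
        Passes i (Fin.snoc j k : Fin (d + 1) → Fin n) (d + 1) t)
      ⊆ (Finset.Ico (s₀ + 1 - n / 2) (s₀ + 1)).image i ∪
        ((Finset.range t).filter fun s => Passes i j d s).image i := by
    intro k hk
    obtain ⟨s, hs, hP, _, τ, hτ, hτ', hi⟩ := (Finset.mem_filter.1 hk).2
    rw [passes_snoc j k le_rfl] at hP
    have hi' : i τ = k := hi.trans (Fin.snoc_last (α := fun _ => Fin n) k j)
    have hle := hmin s ⟨hs, hP⟩
    rw [Finset.mem_union, Finset.mem_image, Finset.mem_image]
    by_cases h : τ ≤ s₀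
    · exact Or.inl ⟨τ, Finset.mem_Ico.2 (by omega), hi'⟩
    · refine Or.inr ⟨τ, Finset.mem_filter.2 ⟨Finset.mem_range.2 (by omega), ?_⟩, hi'⟩
      exact hs0.2.mono (by omega)
  refine (Finset.card_le_card hsub).trans ((Finset.card_union_le _ _).trans ?_)
  refine add_le_add (Finset.card_image_le.trans ?_) Finset.card_image_le
  rw [Nat.card_Ico]
  omega

open Classical in
theorem card_passes_succ_le (i : ℕ → Fin n) (d t : ℕ) :
    (Finset.univ.filter fun j : Fin (d + 1) → Fin n => Passes i j (d + 1) t).card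
      ≤ n / 2 * (Finset.univ.filter fun j : Fin d → Fin n => Passes i j d t).card
        + ∑ s ∈ Finset.range t,
          (Finset.univ.filter fun j : Fin d → Fin n => Passes i j d s).card := by
  have h1 : (Finset.univ.filter fun j : Fin (d + 1) → Fin n => Passes i j (d + 1) t).card
      = ∑ j : Fin d → Fin n, (Finset.univ.filter fun k : Fin n =>
        Passes i (Fin.snoc j k : Fin (d + 1) → Fin n) (d + 1) t).card := by
    simp only [Finset.card_filter]
    rw [← (Fin.snocEquiv fun _ => Fin n).sum_comp, Fintype.sum_prod_type_right]
    rfl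
  rw [h1]
  refine (Finset.sum_le_sum fun j _ => card_next_label_le i j t).trans (le_of_eq ?_)
  rw [Finset.sum_add_distrib]
  congr 1
  · rw [← Finset.sum_filter, Finset.sum_const, smul_eq_mul, mul_comm]
  · simp only [Finset.card_filter]
    exact Finset.sum_comm

open Classical in
/-- Among all labellings, the proportion of those for which `d` links are passed in `t` queries is
at most `(3/4) ^ d (1 + 4/n) ^ t`: in `card_passes_succ_le` the window contributes `n / 2`, and the
geometric sum over the later queries contributes `n / 4`. -/
theorem card_passes_le (hn : 0 < n) (i : ℕ → Fin n) (d t : ℕ) :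
    ((Finset.univ.filter fun j : Fin d → Fin n => Passes i j d t).card : ℝ)
      ≤ (3 / 4 * n) ^ d * (1 + 4 / n) ^ t := by
  have hn' : (0 : ℝ) < n := Nat.cast_pos.2 hn
  have hz : (0 : ℝ) < 4 / n := by positivity
  induction d generalizing t with
  | zero =>
    have := one_le_pow₀ (n := t) (by linarith : (1 : ℝ) ≤ 1 + 4 / n)
    simpa [Passes] using this
  | succ d ih =>
    have hhalf : ((n / 2 : ℕ) : ℝ) ≤ n / 2 := by
      exact_mod_cast Nat.cast_div_le (α := ℝ) (m := n) (n := 2)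
    have hgeom : ∑ s ∈ Finset.range t, (1 + 4 / n : ℝ) ^ s ≤ n / 4 * (1 + 4 / n) ^ t := by
      rw [geom_sum_eq (by linarith), add_sub_cancel_left, div_div_eq_mul_div, mul_comm]
      nlinarith
    calc ((Finset.univ.filter fun j : Fin (d + 1) → Fin n => Passes i j (d + 1) t).card : ℝ)
        ≤ (n / 2 : ℕ) * ((Finset.univ.filter fun j : Fin d → Fin n => Passes i j d t).card : ℝ)
          + ∑ s ∈ Finset.range t,
            ((Finset.univ.filter fun j : Fin d → Fin n => Passes i j d s).card : ℝ) := by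
          exact_mod_cast card_passes_succ_le i d t
      _ ≤ n / 2 * ((3 / 4 * n) ^ d * (1 + 4 / n) ^ t)
          + ∑ s ∈ Finset.range t, (3 / 4 * n : ℝ) ^ d * (1 + 4 / n) ^ s :=
          add_le_add (mul_le_mul hhalf (ih t) (by positivity) (by positivity))
            (Finset.sum_le_sum fun s _ => ih s)
      _ ≤ n / 2 * ((3 / 4 * n) ^ d * (1 + 4 / n) ^ t)
          + (3 / 4 * n : ℝ) ^ d * (n / 4 * (1 + 4 / n) ^ t) := by
          rw [← Finset.mul_sum]
          gcongr
      _ = (3 / 4 * n) ^ (d + 1) * (1 + 4 / n) ^ t := by ring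

open Classical in
theorem card_passes_one_le (i : ℕ → Fin n) (t : ℕ) :
    (Finset.univ.filter fun j : Fin 1 → Fin n => Passes i j 1 t).card ≤ t := by
  have hsub : (Finset.univ.filter fun j : Fin 1 → Fin n => Passes i j 1 t)
      ⊆ (Finset.range t).image fun τ => fun _ => i τ := by
    intro j hj
    obtain ⟨s, hs, -, h, τ, hτ, -, hi⟩ := (Finset.mem_filter.1 hj).2
    refine Finset.mem_image.2 ⟨τ, Finset.mem_range.2 (by omega), funext fun l => ?_⟩
    rw [Subsingleton.elim l ⟨0, h⟩, hi]
  exact (Finset.card_le_card hsub).trans (Finset.card_image_le.trans (Finset.card_range t).le)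

end passes

open Classical in
/-- If, for every sequence of indices, at most half of the labellings let `m` links be passed in `T`
queries, then for some labelling `j` this happens with probability at most `1/2` when the algorithm
is run on `f j`: by obliviousness the law of the indices does not depend on `j`, so that one may
average over `j` under a single law. -/
theorem exists_label_prob_le {Ω : Type*} [MeasurableSpace Ω] {P : Measure Ω}
    [IsProbabilityMeasure P] {n d : ℕ} (hn : 0 < n) {p : ℕ∞} {alg : Algorithm Ω n d p}
    {𝓕 : Set (Fin n → Vec d → ℝ)} (hmeas : alg.IsMeasurable 𝓕) (hobl : alg.IsOblivious P 𝓕)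
    (f : (Fin d → Fin n) → Fin n → Vec d → ℝ) (hf : ∀ j, f j ∈ 𝓕) (m T : ℕ)
    (hcard : ∀ i : ℕ → Fin n,
      2 * (Finset.univ.filter fun j : Fin d → Fin n => Passes i j m T).card ≤ n ^ d) :
    ∃ j, 2 * P {ω | Passes (fun t => alg.queried (f j) ω t) j m T} ≤ 1 := by
  by_contra! hcon
  have : Nonempty (Fin n) := ⟨⟨0, hn⟩⟩
  let j₀ : Fin d → Fin n := Classical.arbitrary _
  set ν := P.map (fun ω t => alg.queried (f j₀) ω t)
  have hq : ∀ j, Measurable fun ω t => alg.queried (f j) ω t := fun j =>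
    measurable_pi_lambda _ fun t => (hmeas _ (hf j) t).2
  have : IsProbabilityMeasure ν := Measure.isProbabilityMeasure_map (hq j₀).aemeasurable
  have hB : ∀ j : Fin d → Fin n, MeasurableSet {i : ℕ → Fin n | Passes i j m T} := fun j =>
    measurableSet_setOfPred.2 (measurable_passes j m T)
  have hν : ∀ j, P {ω | Passes (fun t => alg.queried (f j) ω t) j m T}
      = ν {i | Passes i j m T} := by
    intro j
    rw [show ν = P.map (fun ω t => alg.queried (f j) ω t) from hobl _ (hf j₀) _ (hf j),
      Measure.map_apply (hq j) (hB j)]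
    rfl
  have hlt : ∑ _j : Fin d → Fin n, (1 : ENNReal) < ∑ j, 2 * ν {i | Passes i j m T} :=
    ENNReal.sum_lt_sum_of_nonempty Finset.univ_nonempty fun j _ => hν j ▸ hcon j
  have hle : ∑ j : Fin d → Fin n, 2 * ν {i | Passes i j m T} ≤ (n : ENNReal) ^ d := by
    calc ∑ j : Fin d → Fin n, 2 * ν {i | Passes i j m T}
        = ∫⁻ i, 2 * ∑ j : Fin d → Fin n, Set.indicator {i | Passes i j m T} 1 i ∂ν := by
          rw [lintegral_const_mul _ (Finset.measurable_fun_sum _ fun j _ =>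
              measurable_one.indicator (hB j)),
            lintegral_finsetSum _ fun j _ => measurable_one.indicator (hB j), Finset.mul_sum]
          exact Finset.sum_congr rfl fun j _ => by rw [lintegral_indicator_one (hB j)]
      _ ≤ ∫⁻ _, (n : ENNReal) ^ d ∂ν := by
          refine lintegral_mono fun i => ?_
          have h := hcard i
          rw [Finset.card_filter] at h
          simp only [Set.indicator_apply, Set.mem_ofPred_eq, Pi.one_apply]
          exact_mod_cast h
      _ = (n : ENNReal) ^ d := by simp
  simp at hlt
  exact absurd hle (not_le.2 hlt)

/-! ### The chain -/

/-- The coefficient of `w r` in the difference `w_l - w_{l-1}`, which is `w_0` for `l = 0`. -/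
def chainDiff {d : ℕ} (l r : Fin d) : ℝ :=
  (if r = l then 1 else 0) - (if (r : ℕ) + 1 = l then 1 else 0)

/-- The Hessian of the component `i` of the chain whose link `l` has label `j l`. The last
coordinate gets an additional term, shared equally by the `n` components, of total weight `g`
relative to a link. -/
noncomputable def chainMatrix {n K : ℕ} (lam a g : ℝ) (j : Fin (K + 1) → Fin n) (i : Fin n) :
    Matrix (Fin (K + 1)) (Fin (K + 1)) ℝ :=
  Matrix.of fun r s => (if r = s then lam else 0)
    + 2 * a * (∑ l, if j l = i then chainDiff l r * chainDiff l s else 0)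
    + 2 * a * g / n * (if r = Fin.last K ∧ s = Fin.last K then 1 else 0)

/-- The linear part of the component `i` of the chain. It comes from the square `(w_0 - 1)²` of
link `0`, and hence belongs to the component that has the label of that link. -/
noncomputable def chainVec {n K : ℕ} (a : ℝ) (j : Fin (K + 1) → Fin n) (i : Fin n)
    (r : Fin (K + 1)) : ℝ :=
  if j 0 = i ∧ r = 0 then -(2 * a) else 0

/-- The chain of squares `a (w_l - w_{l-1})²`, `w_{-1} = 1`, in which link `l` is given to the
component `j l`, regularized by `(lam / 2) ‖w‖²`, with the end term of `chainMatrix` and without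
constants. -/
noncomputable def chainInstance {n K : ℕ} (lam a g : ℝ) (j : Fin (K + 1) → Fin n) (i : Fin n) :
    Vec (K + 1) → ℝ :=
  quadFun (chainMatrix lam a g j i) (chainVec a j i)

section chain
variable {n K : ℕ} {lam a g : ℝ}

theorem isSymm_chainMatrix (j : Fin (K + 1) → Fin n) (i : Fin n) :
    (chainMatrix lam a g j i).IsSymm := by
  ext r s
  simp only [chainMatrix, Matrix.transpose_apply, Matrix.of_apply, eq_comm (a := s) (b := r),
    and_comm, mul_comm (chainDiff _ s)]

/-- Component `i` couples the coordinates `l - 1` and `l` only if link `l` has label `i`. -/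
theorem chainMatrix_ne_zero {j : Fin (K + 1) → Fin n} {i : Fin n} {r s : Fin (K + 1)}
    (h : chainMatrix lam a g j i r s ≠ 0) :
    r = s ∨ ((r : ℕ) + 1 = s ∧ j s = i) ∨ ((s : ℕ) + 1 = r ∧ j r = i) := by
  by_contra! hcon
  obtain ⟨h1, h2, h3⟩ := hcon
  apply h
  have hl : ∀ l, (if j l = i then chainDiff l r * chainDiff l s else 0) = 0 := by
    intro l
    split_ifs with hj
    · unfold chainDiff
      by_cases hr : r = l
      · subst hr
        have : ¬ (s : ℕ) + 1 = r := fun e => h3 e hj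
        simp [Ne.symm h1, this]
      · by_cases hs : s = l
        · subst hs
          have : ¬ (r : ℕ) + 1 = s := fun e => h2 e hj
          simp [h1, this]
        · have : ¬ ((r : ℕ) + 1 = l ∧ (s : ℕ) + 1 = l) := fun e => h1 (Fin.ext (by omega))
          by_cases e : (r : ℕ) + 1 = l
          · have e' : ¬ (s : ℕ) + 1 = l := fun e' => this ⟨e, e'⟩
            simp [hs, e']
          · simp [hr, e]
    · rfl
  have hK : ¬ (r = Fin.last K ∧ s = Fin.last K) := fun e => h1 (e.1.trans e.2.symm)
  simp [chainMatrix, h1, hl, hK]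

theorem sum_chainDiff_zero (v : Fin (K + 1) → ℝ) : ∑ r, chainDiff 0 r * v r = v 0 := by
  simp [chainDiff]

theorem sum_chainDiff_succ (k : Fin K) (v : Fin (K + 1) → ℝ) :
    ∑ r, chainDiff k.succ r * v r = v k.succ - v k.castSucc := by
  have h : ∀ r : Fin (K + 1), ((r : ℕ) + 1 = (k.succ : Fin (K + 1))) ↔ r = k.castSucc := fun r => by
    rw [Fin.ext_iff]; simp
  simp only [chainDiff, h, sub_mul]
  simp

theorem sum_chainDiff_castSucc (k : Fin K) (G : Fin (K + 1) → ℝ) :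
    ∑ l, chainDiff l k.castSucc * G l = G k.castSucc - G k.succ := by
  have h : ∀ l : Fin (K + 1), ((k.castSucc : Fin (K + 1)) : ℕ) + 1 = l ↔ k.succ = l := fun l => by
    rw [Fin.ext_iff]; simp
  simp only [chainDiff, h, sub_mul]
  simp

theorem sum_chainDiff_last (G : Fin (K + 1) → ℝ) :
    ∑ l, chainDiff l (Fin.last K) * G l = G (Fin.last K) := by
  have h : ∀ l : Fin (K + 1), ¬ K + 1 = (l : ℕ) := fun l => by omega
  simp [chainDiff, h]

theorem chainMatrix_mulVec (j : Fin (K + 1) → Fin n) (i : Fin n) (v : Fin (K + 1) → ℝ)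
    (r : Fin (K + 1)) :
    ∑ s, chainMatrix lam a g j i r s * v s
      = lam * v r + 2 * a * ∑ l, (if j l = i then chainDiff l r * ∑ s, chainDiff l s * v s else 0)
        + 2 * a * g / n * (if r = Fin.last K then v (Fin.last K) else 0) := by
  simp only [chainMatrix, Matrix.of_apply, add_mul, Finset.sum_add_distrib]
  congr 1
  · congr 1
    · simp
    · simp only [mul_assoc, Finset.sum_mul, ← Finset.mul_sum]
      rw [Finset.sum_comm]
      congr 2
      refine Finset.sum_congr rfl fun l _ => ?_
      split_ifs
      · rw [Finset.mul_sum]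
        exact Finset.sum_congr rfl fun s _ => by ring
      · simp
  · by_cases hr : r = Fin.last K <;> simp [hr]

theorem sum_chainMatrix (j : Fin (K + 1) → Fin n) (i : Fin n) (v : Fin (K + 1) → ℝ) :
    ∑ r, ∑ s, chainMatrix lam a g j i r s * v r * v s
      = lam * ∑ r, v r ^ 2 + 2 * a * ∑ l, (if j l = i then (∑ r, chainDiff l r * v r) ^ 2 else 0)
        + 2 * a * g / n * v (Fin.last K) ^ 2 := by
  have h : ∀ r, ∑ s, chainMatrix lam a g j i r s * v r * v s
      = v r * ∑ s, chainMatrix lam a g j i r s * v s := fun r => by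
    rw [Finset.mul_sum]
    exact Finset.sum_congr rfl fun s _ => by ring
  simp only [h, chainMatrix_mulVec, mul_add, Finset.sum_add_distrib]
  congr 1
  · congr 1
    · rw [Finset.mul_sum]
      exact Finset.sum_congr rfl fun s _ => by ring
    · simp only [Finset.mul_sum]
      rw [Finset.sum_comm]
      refine Finset.sum_congr rfl fun l _ => ?_
      split_ifs
      · rw [sq, Finset.sum_mul, Finset.mul_sum]
        refine Finset.sum_congr rfl fun r _ => ?_
        rw [← Finset.mul_sum]
        ring
      · simp
  · simp
    ring

/-- The last term leaves room for the additional end term of the chain. -/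
theorem sum_chainDiff_sq_le (v : Fin (K + 1) → ℝ) :
    ∑ l, (∑ r, chainDiff l r * v r) ^ 2 ≤ 4 * ∑ r, v r ^ 2 - 2 * v (Fin.last K) ^ 2 := by
  have h1 := Fin.sum_univ_succ fun r => v r ^ 2
  have h2 := Fin.sum_univ_castSucc fun r => v r ^ 2
  have h3 : ∑ k : Fin K, (v k.succ - v k.castSucc) ^ 2
      ≤ 2 * ∑ k : Fin K, v k.succ ^ 2 + 2 * ∑ k : Fin K, v k.castSucc ^ 2 := by
    rw [Finset.mul_sum, Finset.mul_sum, ← Finset.sum_add_distrib]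
    exact Finset.sum_le_sum fun k _ => by nlinarith [sq_nonneg (v k.succ + v k.castSucc)]
  rw [Fin.sum_univ_succ]
  simp only [sum_chainDiff_zero, sum_chainDiff_succ]
  nlinarith [sq_nonneg (v 0)]

theorem chainInstance_mem {mu : ℝ} (hmu : lam ≤ mu) (hg : 0 ≤ g) (hg' : g ≤ 1)
    (j : Fin (K + 1) → Fin n) :
    chainInstance lam ((mu - lam) / 8) g j ∈ quadraticInstances n (K + 1) lam mu := by
  intro i
  refine ⟨isQuadratic_quadFun _, contDiff_quadFun _, fun w v => ?_⟩
  have hn : (1 : ℝ) ≤ n := Nat.one_le_cast.2 (Fin.pos i)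
  rw [chainInstance, iteratedFDeriv_two_quadFun (isSymm_chainMatrix j i), sum_chainMatrix,
    EuclideanSpace.real_norm_sq_eq]
  have ha : 0 ≤ 2 * ((mu - lam) / 8) := by linarith
  have hgn : g / n ≤ 1 := (div_le_one (by linarith)).2 (hg'.trans hn)
  have hgn0 : 0 ≤ g / n := by positivity
  have h0 : 0 ≤ ∑ l, (if j l = i then (∑ r, chainDiff l r * v r) ^ 2 else 0) :=
    Finset.sum_nonneg fun l _ => by split_ifs <;> positivity
  have h1 : ∑ l, (if j l = i then (∑ r, chainDiff l r * v r) ^ 2 else 0)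
      ≤ ∑ l, (∑ r, chainDiff l r * v r) ^ 2 :=
    Finset.sum_le_sum fun l _ => by split_ifs <;> first | exact le_rfl | positivity
  have h2 := sum_chainDiff_sq_le v
  have hK := sq_nonneg (v (Fin.last K))
  rw [mul_div_assoc, mul_assoc (2 * ((mu - lam) / 8)), add_assoc, ← mul_add]
  constructor
  · have := mul_nonneg ha (add_nonneg h0 (mul_nonneg hgn0 hK))
    linarith
  · have h3 : ∑ l, (if j l = i then (∑ r, chainDiff l r * v r) ^ 2 else 0)
        + g / n * v (Fin.last K) ^ 2 ≤ 4 * ∑ r, v r ^ 2 := by nlinarith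
    have := mul_le_mul_of_nonneg_left h3 ha
    linarith

/-- Around a critical point of a sum of quadratics, the sum is its second-order part. -/
theorem sum_quadFun_sub {d : ℕ} {A : Fin n → Matrix (Fin d) (Fin d) ℝ} (hA : ∀ i, (A i).IsSymm)
    {b : Fin n → Fin d → ℝ} {v : Vec d}
    (hv : ∀ r, ∑ i, (∑ s, A i r s * v s + b i r) = 0) (w : Vec d) :
    ∑ i, quadFun (A i) (b i) w - ∑ i, quadFun (A i) (b i) v
      = 1 / 2 * ∑ i, ∑ r, ∑ s, A i r s * (w r - v r) * (w s - v s) := by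
  rw [← Finset.sum_sub_distrib, Finset.sum_congr rfl fun i _ => quadFun_sub (hA i) (b i) w v,
    Finset.sum_add_distrib, Finset.mul_sum, Finset.sum_comm (γ := Fin n)]
  simp only [← Finset.sum_mul, hv, zero_mul, Finset.sum_const_zero, add_zero]

theorem sum_quadFun_zero_sub {d : ℕ} {A : Fin n → Matrix (Fin d) (Fin d) ℝ}
    (hA : ∀ i, (A i).IsSymm) {b : Fin n → Fin d → ℝ} {v : Vec d}
    (hv : ∀ r, ∑ i, (∑ s, A i r s * v s + b i r) = 0) :
    ∑ i, quadFun (A i) (b i) 0 - ∑ i, quadFun (A i) (b i) v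
      = -(1 / 2 * ∑ i, ∑ r, b i r * v r) := by
  have h := sum_quadFun_sub hA hv 0
  have h' : ∑ i, quadFun (A i) (b i) v
      = 1 / 2 * (∑ i, ∑ r, ∑ s, A i r s * v r * v s) + ∑ i, ∑ r, b i r * v r := by
    simp only [quadFun, Finset.sum_add_distrib, Finset.mul_sum]
  have h0 : ∑ i, quadFun (A i) (b i) 0 = 0 := by simp [quadFun]
  simp only [PiLp.zero_apply, zero_sub, mul_neg, neg_mul, neg_neg] at h
  linarith

/-- The minimizer `w_l = q ^ (l + 1)` of the mean of the chain. -/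
noncomputable def chainMinimizer (K : ℕ) (q : ℝ) : Vec (K + 1) :=
  WithLp.toLp 2 fun r => q ^ ((r : ℕ) + 1)

/-- The gradient of the mean of the chain vanishes at `chainMinimizer`. The relation `hq` is the
recurrence at an interior coordinate; the end weight `1 - q` makes it hold at the last one too. -/
theorem chain_stationary {q : ℝ} (hn : 0 < n) (hq : n * lam * q = 2 * a * (1 - q) ^ 2)
    (j : Fin (K + 1) → Fin n) (r : Fin (K + 1)) :
    ∑ i, (∑ s, chainMatrix lam a (1 - q) j i r s * chainMinimizer K q s + chainVec a j i r)
      = 0 := by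
  have hn' : (n : ℝ) ≠ 0 := by positivity
  set v := chainMinimizer K q with hvdef
  have hv : ∀ r, v r = q ^ ((r : ℕ) + 1) := fun r => rfl
  -- Link `0` contributes `v 0 = (q - 1) + 1`, and the last summand cancels the linear part.
  have hG : ∀ l : Fin (K + 1), ∑ s, chainDiff l s * v s
      = (q ^ ((l : ℕ) + 1) - q ^ (l : ℕ)) + (if l = 0 then 1 else 0) := by
    intro l
    induction l using Fin.cases with
    | zero => rw [sum_chainDiff_zero]; simp [hv]
    | succ k => rw [sum_chainDiff_succ]; simp [hv, Fin.succ_ne_zero]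
  have hb : ∑ i, chainVec a j i r = -(2 * a * chainDiff 0 r) := by
    by_cases hr : r = 0 <;> simp [chainVec, chainDiff, hr]
  have hA : ∑ i, ∑ s, chainMatrix lam a (1 - q) j i r s * v s
      = n * lam * v r + 2 * a * (∑ l, chainDiff l r * ∑ s, chainDiff l s * v s)
        + 2 * a * (1 - q) * (if r = Fin.last K then v (Fin.last K) else 0) := by
    simp only [chainMatrix_mulVec, Finset.sum_add_distrib, ← Finset.mul_sum]
    rw [Finset.sum_comm]
    simp
    field_simp
  rw [Finset.sum_add_distrib, hb, hA]
  simp only [hG, mul_add, Finset.sum_add_distrib]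
  simp only [mul_ite, mul_one, mul_zero, Finset.sum_ite_eq', Finset.mem_univ, if_true]
  induction r using Fin.lastCases with
  | last =>
    rw [sum_chainDiff_last]
    simp only [hv, Fin.val_last, if_true]
    linear_combination q ^ K * hq
  | cast k =>
    rw [sum_chainDiff_castSucc, if_neg (Fin.castSucc_lt_last k).ne]
    simp only [hv, Fin.val_castSucc, Fin.val_succ]
    linear_combination q ^ (k : ℕ) * hq

theorem meanObjective_chain_sub_ge {q : ℝ} (hn : 0 < n) (ha : 0 ≤ a) (hq1 : q ≤ 1)
    (hq : n * lam * q = 2 * a * (1 - q) ^ 2) (j : Fin (K + 1) → Fin n) (w : Vec (K + 1)) :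
    lam / 2 * ∑ r, (w r - chainMinimizer K q r) ^ 2
      ≤ meanObjective (chainInstance lam a (1 - q) j) w
        - meanObjective (chainInstance lam a (1 - q) j) (chainMinimizer K q) := by
  have hn' : (0 : ℝ) < n := Nat.cast_pos.2 hn
  have h : ∀ i, lam * ∑ r, (w r - chainMinimizer K q r) ^ 2
      ≤ ∑ r, ∑ s, chainMatrix lam a (1 - q) j i r s * (w r - chainMinimizer K q r)
        * (w s - chainMinimizer K q s) := by
    intro i
    rw [sum_chainMatrix j i fun r => w r - chainMinimizer K q r, add_assoc]
    refine le_add_of_nonneg_right ?_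
    have : 0 ≤ ∑ l, (if j l = i then
        (∑ r, chainDiff l r * (w r - chainMinimizer K q r)) ^ 2 else 0) :=
      Finset.sum_nonneg fun l _ => by split_ifs <;> positivity
    have : 0 ≤ 1 - q := sub_nonneg.2 hq1
    positivity
  have h' := Finset.sum_le_sum fun i (_ : i ∈ (Finset.univ : Finset (Fin n))) => h i
  rw [Finset.sum_const, Finset.card_univ, Fintype.card_fin, nsmul_eq_mul] at h'
  unfold meanObjective chainInstance
  rw [← mul_sub, sum_quadFun_sub (isSymm_chainMatrix j) (chain_stationary hn hq j) w,
    one_div, ← div_eq_inv_mul, le_div_iff₀ hn']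
  linarith

theorem meanObjective_chain_zero_sub {q : ℝ} (hn : 0 < n)
    (hq : n * lam * q = 2 * a * (1 - q) ^ 2) (j : Fin (K + 1) → Fin n) :
    meanObjective (chainInstance lam a (1 - q) j) 0
        - meanObjective (chainInstance lam a (1 - q) j) (chainMinimizer K q) = a * q / n := by
  have hb : ∀ r, ∑ i, chainVec a j i r * chainMinimizer K q r = if r = 0 then -(2 * a * q) else 0 := by
    intro r
    by_cases hr : r = 0 <;> simp [chainVec, chainMinimizer, hr]
  unfold meanObjective chainInstance
  rw [← mul_sub, sum_quadFun_zero_sub (isSymm_chainMatrix j) (chain_stationary hn hq j),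
    Finset.sum_comm]
  simp only [hb]
  simp
  ring

/-! ### Reachable points of the chain -/

/-- A coordinate `l` of a reachable point can be nonzero only if the links `0, …, l` are passed. -/
theorem reachable_chainInstance (hn : 1 < n) (j : Fin (K + 1) → Fin n)
    (w : ℕ → Vec (K + 1)) (i : ℕ → Fin n)
    (hw : ∀ t, w t ∈ reachable (chainInstance lam a g j) w i t) (t : ℕ) :
    reachable (chainInstance lam a g j) w i t
      ⊆ {v | ∀ l : Fin (K + 1), ¬ Passes i j (l + 1) t → v l = 0} := by
  induction t with
  | zero => rintro v rfl l -; rfl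
  | succ t ih =>
    have hn2 : 0 < n / 2 := by omega
    have hM : ∀ H ∈ allowedMatrices (chainInstance lam a g j) w i t, ∀ r s : Fin (K + 1),
        ¬ Passes i j (r + 1) (t + 1) → Passes i j (s + 1) (t + 1) → H r s = 0 := by
      classical
      rintro H ⟨α, hα⟩ r s hr hs
      -- The passed coordinates form an initial segment, which the allowed matrices preserve:
      -- a Hessian in the window that couples it to the rest would let one more link be passed.
      set b : Fin (K + 1) → ℕ := fun r => if Passes i j (r + 1) (t + 1) then 0 else 1 with hb
      have hmono : Monotone b := by
        intro r s hrs
        simp only [hb]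
        split_ifs with h1 h2 h2
        · exact le_rfl
        · exact zero_le_one
        · exact absurd (h2.antitone (by simpa using hrs)) h1
        · exact le_rfl
      refine hα b hmono ?_ r s (by simp [hb, hr, hs])
      intro r s hrs
      rw [Matrix.sum_apply]
      refine Finset.sum_eq_zero fun τ hτ => ?_
      rw [Finset.mem_filter, Finset.mem_range] at hτ
      rw [Matrix.smul_apply, chainInstance, hessianMatrix_quadFun (isSymm_chainMatrix j _),
        smul_eq_mul]
      refine mul_eq_zero_of_right _ ?_
      by_contra hne
      refine hrs ?_
      simp only [hb]
      rcases chainMatrix_ne_zero hne with h | ⟨h, hj⟩ | ⟨h, hj⟩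
      · rw [h]
      · have : Passes i j (r + 1) (t + 1) ↔ Passes i j (s + 1) (t + 1) :=
          ⟨fun hP => Passes.step s.2 (h ▸ hP) (by omega) hτ.2 hj.symm,
            fun hP => hP.antitone (by omega)⟩
        simp only [this]
      · have : Passes i j (s + 1) (t + 1) ↔ Passes i j (r + 1) (t + 1) :=
          ⟨fun hP => Passes.step r.2 (h ▸ hP) (by omega) hτ.2 hj.symm,
            fun hP => hP.antitone (by omega)⟩
        simp only [this]
    have hgrad : ∀ l : Fin (K + 1), ¬ Passes i j (l + 1) (t + 1) →
        gradient (chainInstance lam a g j (i t)) (w t) l = 0 := by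
      intro l hl
      rw [chainInstance, gradient_quadFun (isSymm_chainMatrix j _)]
      have h0 : chainVec a j (i t) l = 0 := by
        refine if_neg fun h => hl ?_
        obtain ⟨h, rfl⟩ := h
        exact Passes.step (Nat.succ_pos K) trivial le_rfl (by omega) h.symm
      rw [h0, add_zero]
      refine Finset.sum_eq_zero fun s _ => ?_
      by_contra hne
      have hP : Passes i j (s + 1) t := by
        by_contra hP
        exact right_ne_zero_of_mul hne (ih (hw t) s hP)
      have hP' := hP.mono t.le_succ
      rcases chainMatrix_ne_zero (left_ne_zero_of_mul hne) with h | ⟨h, hj⟩ | ⟨h, hj⟩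
      · exact hl (h ▸ hP')
      · exact hl (hP'.antitone (by omega))
      · exact hl (Passes.step l.2 (h ▸ hP') le_rfl (by omega) hj.symm)
    refine closure_minimal ?_ ?_
    · intro v hv
      induction hv with
      | base v hv =>
        rcases hv with hv | rfl
        · exact fun l hl => ih hv l fun h => hl (h.mono t.le_succ)
        · exact hgrad
      | comb α α' v v' _ _ h h' => exact fun l hl => by simp [h l hl, h' l hl]
      | mul H hH v _ h =>
        intro l hl
        change ∑ s, H l s * v s = 0
        refine Finset.sum_eq_zero fun s _ => ?_
        by_cases hs : Passes i j (s + 1) (t + 1)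
        · rw [hM H hH l s hl hs, zero_mul]
        · rw [h s hs, mul_zero]
    · simp only [Set.ofPred_forall]
      refine isClosed_iInter fun l => isClosed_iInter fun _ => ?_
      exact isClosed_eq (by fun_prop) continuous_const

end chain

/-! ### Hardness of the chain for some labelling -/

/-- As long as the last coordinate is zero, the suboptimality is at least a fixed part of that
of `0`. In dimension one the point is `0` itself. -/
theorem le_meanObjective_chain_sub {n K : ℕ} {lam a q ε : ℝ} (hn : 0 < n) (hlam : 0 < lam)
    (ha : 0 ≤ a) (hq1 : q ≤ 1) (hq : n * lam * q = 2 * a * (1 - q) ^ 2)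
    (hε : 2 * ε ≤ q ^ (2 * K) * (1 - q) ^ 2 ∨ K = 0 ∧ 2 * ε ≤ 1)
    (hq0 : 0 ≤ q) (j : Fin (K + 1) → Fin n) {w : Vec (K + 1)} (hw : w (Fin.last K) = 0) :
    2 * ε * (meanObjective (chainInstance lam a (1 - q) j) 0
        - meanObjective (chainInstance lam a (1 - q) j) (chainMinimizer K q))
      ≤ meanObjective (chainInstance lam a (1 - q) j) w
        - meanObjective (chainInstance lam a (1 - q) j) (chainMinimizer K q) := by
  have hn' : (0 : ℝ) < n := Nat.cast_pos.2 hn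
  have hΔ : 0 ≤ a * q / n := by positivity
  rcases hε with hε | ⟨rfl, hε⟩
  · refine le_trans ?_ (meanObjective_chain_sub_ge hn ha hq1 hq j w)
    have h1 : (q ^ (K + 1)) ^ 2 ≤ ∑ r, (w r - chainMinimizer K q r) ^ 2 := by
      refine le_trans (le_of_eq ?_) (Finset.single_le_sum
        (f := fun r => (w r - chainMinimizer K q r) ^ 2) (fun r _ => sq_nonneg _)
        (Finset.mem_univ (Fin.last K)))
      simp [hw, chainMinimizer]
    rw [meanObjective_chain_zero_sub hn hq j]
    calc 2 * ε * (a * q / n) ≤ q ^ (2 * K) * (1 - q) ^ 2 * (a * q / n) :=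
          mul_le_mul_of_nonneg_right hε hΔ
      _ = lam / 2 * (q ^ (K + 1)) ^ 2 := by
          field_simp
          linear_combination -q ^ (2 * K + 1) * hq
      _ ≤ _ := mul_le_mul_of_nonneg_left h1 (by linarith)
  · have hw0 : w = 0 := by
      ext r
      rw [show r = Fin.last 0 from Subsingleton.elim (α := Fin 1) _ _, hw]
      rfl
    rw [hw0, meanObjective_chain_zero_sub hn hq j]
    nlinarith

open Classical in
/-- If at most half of the labellings let the whole chain be passed in `T` queries, then some
labelling is hard for the algorithm during its first `T + 1` queries. -/
theorem exists_hard_chain {n K : ℕ} {lam mu q ε : ℝ} (hn : 1 < n) (hlam : 0 < lam)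
    (hmu : lam < mu) (hq0 : 0 < q) (hq1 : q ≤ 1)
    (hq : n * lam * q = 2 * ((mu - lam) / 8) * (1 - q) ^ 2) {δ : ℝ} (hεδ : ε < δ)
    (hδ0 : 0 < δ)
    (hδ : 2 * δ ≤ q ^ (2 * K) * (1 - q) ^ 2 ∨ K = 0 ∧ 2 * δ ≤ 1) {T : ℕ}
    (hcard : ∀ i : ℕ → Fin n,
      2 * (Finset.univ.filter fun j : Fin (K + 1) → Fin n => Passes i j (K + 1) T).card
        ≤ n ^ (K + 1))
    {p : ℕ∞} {Ω : Type*} [MeasurableSpace Ω] {P : Measure Ω} [IsProbabilityMeasure P]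
    (alg : Algorithm Ω n (K + 1) p)
    (hmeas : alg.IsMeasurable (quadraticInstances n (K + 1) lam mu))
    (hlin : alg.IsLinearAlgebraic P (quadraticInstances n (K + 1) lam mu))
    (hobl : alg.IsOblivious P (quadraticInstances n (K + 1) lam mu)) :
    ∃ f ∈ quadraticInstances n (K + 1) lam mu, ∃ wstar : Vec (K + 1),
      (∀ w, meanObjective f wstar ≤ meanObjective f w) ∧ ∀ t ≤ T,
        ENNReal.ofReal (ε * (meanObjective f 0 - meanObjective f wstar)) <
          ∫⁻ ω, ENNReal.ofReal (meanObjective f (alg.iterate f ω t) - meanObjective f wstar) ∂P := by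
  have hn0 : 0 < n := by omega
  have hn' : (0 : ℝ) < n := Nat.cast_pos.2 hn0
  set a := (mu - lam) / 8 with ha
  have ha0 : 0 < a := by rw [ha]; linarith
  have hmem : ∀ j : Fin (K + 1) → Fin n, chainInstance lam a (1 - q) j
      ∈ quadraticInstances n (K + 1) lam mu := fun j =>
    chainInstance_mem hmu.le (by linarith) (by linarith) j
  obtain ⟨j, hj⟩ := exists_label_prob_le hn0 hmeas hobl (fun j => chainInstance lam a (1 - q) j)
    hmem (K + 1) T hcard
  refine ⟨_, hmem j, chainMinimizer K q, fun w => ?_, fun t ht => ?_⟩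
  · refine sub_nonneg.1 (le_trans ?_ (meanObjective_chain_sub_ge hn0 ha0.le hq1 hq j w))
    positivity
  set f := chainInstance lam a (1 - q) j with hf
  set Δ := meanObjective f 0 - meanObjective f (chainMinimizer K q) with hΔ
  have hΔ0 : 0 < Δ := by
    rw [hΔ, hf, meanObjective_chain_zero_sub hn0 hq j]
    positivity
  set B := {ω | Passes (fun t => alg.queried f ω t) j (K + 1) T} with hBdef
  have hB : MeasurableSet B := measurableSet_setOfPred.2 <|
    (measurable_passes j (K + 1) T).comp
      (measurable_pi_lambda (fun ω t => alg.queried f ω t) fun t => (hmeas _ (hmem j) t).2)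
  have hBc : 1 ≤ 2 * P Bᶜ := by
    have h1 : 2 * P B + 2 * P Bᶜ = 2 := by rw [← mul_add, prob_add_prob_compl hB, mul_one]
    by_contra! hlt
    have : 2 * P B + 2 * P Bᶜ < 1 + 1 := ENNReal.add_lt_add_of_le_of_lt
      (ne_top_of_le_ne_top ENNReal.one_ne_top hj) hj hlt
    rw [h1, one_add_one_eq_two] at this
    exact lt_irrefl _ this
  calc ENNReal.ofReal (ε * Δ) < ENNReal.ofReal (δ * Δ) := by
        rw [ENNReal.ofReal_lt_ofReal_iff (by positivity)]
        exact mul_lt_mul_of_pos_right hεδ hΔ0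
    _ ≤ ENNReal.ofReal (δ * Δ) * (2 * P Bᶜ) := le_mul_of_one_le_right' hBc
    _ = ENNReal.ofReal (2 * δ * Δ) * P Bᶜ := by
        rw [mul_assoc 2, ENNReal.ofReal_mul zero_le_two, ENNReal.ofReal_ofNat]
        ring
    _ = ∫⁻ _ in Bᶜ, ENNReal.ofReal (2 * δ * Δ) ∂P := by rw [setLIntegral_const]
    _ ≤ ∫⁻ ω in Bᶜ, ENNReal.ofReal (meanObjective f (alg.iterate f ω t)
          - meanObjective f (chainMinimizer K q)) ∂P := by
        refine lintegral_mono_ae ((ae_restrict_iff' hB.compl).2 ?_)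
        filter_upwards [hlin _ (hmem j)] with ω hω hωB
        refine ENNReal.ofReal_le_ofReal ?_
        refine le_meanObjective_chain_sub hn0 hlam ha0.le hq1 hq hδ hq0.le j ?_
        refine reachable_chainInstance hn j _ _ hω t (hω t) (Fin.last K) fun h => hωB ?_
        exact h.mono ht
    _ ≤ _ := setLIntegral_le_lintegral _ _

/-! ### The choice of parameters -/

/-- The decay rate `q = exp (-2 arsinh x)` of the chain, and its size. -/
theorem contraction_facts {x : ℝ} (hx : 0 < x) :
    ∃ q : ℝ, 0 < q ∧ q < 1 ∧ (1 - q) ^ 2 = 4 * x ^ 2 * q ∧ Real.exp (-(2 * x)) ≤ q ∧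
      x ^ 2 / (1 + x ^ 2) ≤ (1 - q) ^ 2 := by
  -- For `q = exp (-2y)` the equation `(1 - q)² = 4 x² q` says `sinh y = x`.
  set y := Real.arsinh x with hy
  have hy0 : 0 < y := Real.arsinh_pos_iff.2 hx
  have hyx : y ≤ x := by
    have := Real.self_le_sinh_iff.2 hy0.le
    rwa [hy, Real.sinh_arsinh] at this
  have hs : Real.exp y - Real.exp (-y) = 2 * x := by
    have := Real.sinh_arsinh x
    rw [← hy, Real.sinh_eq] at this
    linarith
  have he : Real.exp y * Real.exp (-y) = 1 := by rw [← Real.exp_add]; simp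
  have hE := Real.exp_pos (-y)
  generalize hz : Real.exp (-y) = z at *
  generalize Real.exp y = u at *
  have hqz : Real.exp (-(2 * y)) = z ^ 2 := by rw [← hz, ← Real.exp_nat_mul]; congr 1; push_cast; ring
  have h1 : 1 - z ^ 2 = 2 * x * z := by linear_combination z * hs - he
  refine ⟨z ^ 2, by positivity, by nlinarith, by rw [h1]; ring, ?_, ?_⟩
  · rw [← hqz]
    exact Real.exp_le_exp.2 (by linarith)
  · have hc : (u + z) ^ 2 = 4 * (1 + x ^ 2) := by linear_combination (u - z + 2 * x) * hs + 4 * he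
    have hzu : z ≤ u := by linarith
    have hu : 1 ≤ 4 * z ^ 2 * (1 + x ^ 2) := by
      have : z * (u + z) = 1 + z ^ 2 := by linear_combination he
      have h2 : 4 * z ^ 2 * (1 + x ^ 2) = (1 + z ^ 2) ^ 2 := by
        rw [← this]; linear_combination -z ^ 2 * hc
      rw [h2]
      nlinarith [sq_nonneg z]
    rw [h1, div_le_iff₀ (by positivity)]
    nlinarith [mul_le_mul_of_nonneg_left hu (sq_nonneg x)]

/-- With at least `L / (16 x)` links and at most `n L / (512 x)` queries, the bound of
`card_passes_le` is at most half of the labellings. -/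
theorem card_bound_of_large {n K T : ℕ} {x L : ℝ} (hn : 0 < n) (hx : 0 < x) (hL : 128 * x ≤ L)
    (hK : L / (16 * x) ≤ K + 1) (hT : T ≤ n * L / (512 * x)) {N : ℕ}
    (hN : (N : ℝ) ≤ (3 / 4 * n) ^ (K + 1) * (1 + 4 / n) ^ T) : 2 * N ≤ n ^ (K + 1) := by
  have hn' : (0 : ℝ) < n := Nat.cast_pos.2 hn
  have hratio : 128 ≤ L / x := (le_div_iff₀ hx).2 hL
  have h1 : (1 + 4 / n : ℝ) ^ T ≤ Real.exp (L / x / 128) := by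
    calc (1 + 4 / n : ℝ) ^ T ≤ Real.exp (4 / n) ^ T := by
          refine pow_le_pow_left₀ (by positivity) ?_ T
          have := Real.add_one_le_exp (4 / n : ℝ)
          linarith
      _ = Real.exp (T * (4 / n)) := by rw [← Real.exp_nat_mul]
      _ ≤ Real.exp (L / x / 128) := by
          refine Real.exp_le_exp.2 ((mul_le_mul_of_nonneg_right hT (by positivity)).trans_eq ?_)
          field_simp
          ring
  have h2 : (3 / 4 : ℝ) ^ (K + 1) ≤ Real.exp (-(L / x / 64)) := by
    calc (3 / 4 : ℝ) ^ (K + 1) ≤ Real.exp (-(1 / 4)) ^ (K + 1) := by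
          refine pow_le_pow_left₀ (by norm_num) ?_ _
          have := Real.add_one_le_exp (-(1 / 4) : ℝ)
          linarith
      _ = Real.exp ((K + 1 : ℕ) * (-(1 / 4))) := by rw [← Real.exp_nat_mul]
      _ ≤ Real.exp (-(L / x / 64)) := by
          refine Real.exp_le_exp.2 ?_
          rw [mul_comm 16 x, ← div_div] at hK
          push_cast
          linarith
  have h3 : (3 / 4 : ℝ) ^ (K + 1) * (1 + 4 / n : ℝ) ^ T ≤ 1 / 2 := by
    calc (3 / 4 : ℝ) ^ (K + 1) * (1 + 4 / n : ℝ) ^ T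
        ≤ Real.exp (-(L / x / 64)) * Real.exp (L / x / 128) :=
          mul_le_mul h2 h1 (by positivity) (by positivity)
      _ = Real.exp (-(L / x / 128)) := by rw [← Real.exp_add]; ring_nf
      _ ≤ Real.exp (-1) := Real.exp_le_exp.2 (by linarith)
      _ ≤ 1 / 2 := by
          rw [Real.exp_neg, one_div]
          have := Real.add_one_le_exp (1 : ℝ)
          exact inv_anti₀ two_pos (by linarith)
  have h4 : (2 * N : ℝ) ≤ (n : ℝ) ^ (K + 1) := by
    rw [mul_pow] at hN
    have := mul_le_mul_of_nonneg_left h3 (pow_nonneg hn'.le (K + 1))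
    linarith
  exact_mod_cast h4

/-- With `K + 1` links, `K ≤ L / (16 x)`, the accuracy that is guaranteed to be missed exceeds `ε`. Here
`ρ` is `λ / μ`, and the hypothesis `hρ` says `x² = n / (κ - 1)` with `κ = 1 / ρ`. -/
theorem accuracy_of_large {n K : ℕ} {ρ ε x q L : ℝ} (hn : 0 < n) (hx : 0 < x) (hL : 128 * x ≤ L)
    (hρ0 : 0 < ρ) (hρ : n * ρ = x ^ 2 * (1 - ρ)) (hε : 0 < ε)
    (hLdef : L = Real.log (ρ ^ (3 / 2 : ℝ) * √n / ε)) (hK : K ≤ L / (16 * x))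
    (hq : Real.exp (-(2 * x)) ≤ q) (hq' : x ^ 2 / (1 + x ^ 2) ≤ (1 - q) ^ 2) :
    2 * ε < q ^ (2 * K) * (1 - q) ^ 2 := by
  have hn' : (1 : ℝ) ≤ n := Nat.one_le_cast.2 hn
  have hexp : Real.exp L * ε = ρ ^ (3 / 2 : ℝ) * √n := by
    rw [hLdef, Real.exp_log (by positivity), div_mul_cancel₀ _ hε.ne']
  have hpow : ρ ^ (3 / 2 : ℝ) * √n ≤ ρ * x := by
    rw [show (3 / 2 : ℝ) = 1 + 1 / 2 by norm_num, Real.rpow_add hρ0, Real.rpow_one,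
      ← Real.sqrt_eq_rpow, mul_assoc, ← Real.sqrt_mul hρ0.le]
    refine mul_le_mul_of_nonneg_left (Real.sqrt_le_iff.2 ⟨hx.le, ?_⟩) hρ0.le
    nlinarith [mul_pos (pow_pos hx 2) hρ0]
  have hρx : ρ * (1 + x ^ 2) ≤ x ^ 2 := by nlinarith
  have hqK : Real.exp (-(L / 4)) ≤ q ^ (2 * K) := by
    calc Real.exp (-(L / 4)) ≤ Real.exp ((2 * K : ℕ) * (-(2 * x))) := by
          refine Real.exp_le_exp.2 ?_
          rw [le_div_iff₀ (by positivity)] at hK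
          push_cast
          linarith
      _ = Real.exp (-(2 * x)) ^ (2 * K) := by rw [Real.exp_nat_mul]
      _ ≤ q ^ (2 * K) := pow_le_pow_left₀ (Real.exp_pos _).le hq _
  refine lt_of_lt_of_le ?_ (mul_le_mul hqK hq' (by positivity) ((Real.exp_pos _).le.trans hqK))
  rw [mul_div_assoc', lt_div_iff₀ (by positivity)]
  have h1 : Real.exp L * Real.exp (-(L / 4)) = Real.exp (3 * L / 4) := by
    rw [← Real.exp_add]; ring_nf
  have h2 := Real.add_one_le_exp (3 * L / 4)
  refine lt_of_mul_lt_mul_left ?_ (Real.exp_pos L).le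
  calc Real.exp L * (2 * ε * (1 + x ^ 2)) = 2 * (Real.exp L * ε) * (1 + x ^ 2) := by ring
    _ ≤ 2 * (ρ * x) * (1 + x ^ 2) := by rw [hexp]; gcongr
    _ ≤ 2 * x * x ^ 2 := by nlinarith
    _ < Real.exp (3 * L / 4) * x ^ 2 := by
        have : 2 * x < Real.exp (3 * L / 4) := by linarith
        exact mul_lt_mul_of_pos_right this (by positivity)
    _ = Real.exp L * (Real.exp (-(L / 4)) * x ^ 2) := by rw [← h1]; ring

open Classical in
/-- The choice of the number of links and of queries: a chain of length of order `L / x` if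
`128 x ≤ L`, and a single link otherwise. -/
theorem exists_chain_parameters {n : ℕ} {lam mu ε : ℝ} (hn : 1 < n) (hlam : 0 < lam)
    (hmu : lam < mu) (hε0 : 0 < ε) (hε : ε < 1 / 2) :
    ∃ (K T : ℕ) (q δ : ℝ),
      (K + 1 : ℝ) ≤ (1 + √(mu / (lam * n))) * Real.log (n * (mu / lam) / ε) ∧
      0 < q ∧ q ≤ 1 ∧ n * lam * q = 2 * ((mu - lam) / 8) * (1 - q) ^ 2 ∧ ε < δ ∧
      (2 * δ ≤ q ^ (2 * K) * (1 - q) ^ 2 ∨ K = 0 ∧ 2 * δ ≤ 1) ∧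
      (∀ i : ℕ → Fin n,
        2 * (Finset.univ.filter fun j : Fin (K + 1) → Fin n => Passes i j (K + 1) T).card
          ≤ n ^ (K + 1)) ∧
      1 / 1000 * (n + √(n * (mu / lam - 1))
        * max 0 (Real.log ((lam / mu) ^ (3 / 2 : ℝ) * √n / ε))) ≤ T + 1 := by
  have hn0 : 0 < n := by omega
  have hn' : (1 : ℝ) < n := Nat.one_lt_cast.2 hn
  have hmu0 : 0 < mu := hlam.trans hmu
  set L := Real.log ((lam / mu) ^ (3 / 2 : ℝ) * √n / ε) with hL
  set Λ := Real.log (n * (mu / lam) / ε) with hΛ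
  have hκ : 1 < mu / lam := (one_lt_div hlam).2 hmu
  set κ := mu / lam with hκdef
  have hρ : lam / mu = κ⁻¹ := by rw [hκdef, inv_div]
  have hρ0 : 0 < lam / mu := by positivity
  have hx : 0 < √(n / (κ - 1)) := Real.sqrt_pos.2 (div_pos (by linarith) (by linarith))
  have hxsq : √(n / (κ - 1)) ^ 2 * (κ - 1) = n := by
    rw [Real.sq_sqrt (div_nonneg (by linarith) (by linarith)), div_mul_cancel₀ _ (by linarith)]
  have hS : √(n * (κ - 1)) * √(n / (κ - 1)) = n := by
    rw [← Real.sqrt_mul (mul_nonneg (by linarith) (by linarith))]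
    rw [show n * (κ - 1) * (n / (κ - 1)) = (n : ℝ) ^ 2 by
      have : κ - 1 ≠ 0 := by linarith
      field_simp]
    exact Real.sqrt_sq (by linarith)
  have hinv : (√(n / (κ - 1)))⁻¹ ≤ √(mu / (lam * n)) := by
    rw [← Real.sqrt_inv, inv_div]
    refine Real.sqrt_le_sqrt ?_
    rw [← div_div, ← hκdef]
    gcongr
    linarith
  generalize √(n / (κ - 1)) = x at *
  generalize √(mu / (lam * n)) = R at *
  have hR : 0 < R := lt_of_lt_of_le (inv_pos.2 hx) hinv
  have hΛ1 : 1 ≤ Λ := by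
    rw [hΛ, Real.le_log_iff_exp_le (by positivity), le_div_iff₀ hε0]
    have h1 := Real.exp_one_lt_d9
    have h2 : (2 : ℝ) ≤ n := by exact_mod_cast hn
    nlinarith [Real.exp_pos 1]
  have hLΛ : L ≤ Λ := by
    refine Real.log_le_log (by positivity) ?_
    refine div_le_div_of_nonneg_right ?_ hε0.le
    have h1 : (lam / mu) ^ (3 / 2 : ℝ) ≤ 1 :=
      Real.rpow_le_one hρ0.le (by rw [hρ]; exact inv_le_one_of_one_le₀ hκ.le) (by norm_num)
    have h2 : √n ≤ n := Real.sqrt_le_iff.2 ⟨by linarith, by nlinarith⟩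
    calc (lam / mu) ^ (3 / 2 : ℝ) * √n ≤ 1 * n :=
          mul_le_mul h1 h2 (Real.sqrt_nonneg _) zero_le_one
      _ ≤ n * (mu / lam) := by rw [mul_comm, ← hκdef]; gcongr
  obtain ⟨q, hq0, hq1, hqsq, hqexp, hqlow⟩ := contraction_facts hx
  have hqrel : n * lam * q = 2 * ((mu - lam) / 8) * (1 - q) ^ 2 := by
    have hmul : mu = κ * lam := by rw [hκdef, div_mul_cancel₀ _ hlam.ne']
    rw [hqsq, ← hxsq, hmul]
    ring
  by_cases hcase : 128 * x ≤ L
  · have hL0 : 0 < L := by linarith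
    have hKle := Nat.floor_le (a := L / (16 * x)) (by positivity)
    have hKlt := (Nat.lt_floor_add_one (L / (16 * x))).le
    have hTle := Nat.floor_le (a := n * L / (512 * x)) (by positivity)
    have hTlt := (Nat.lt_floor_add_one (n * L / (512 * x))).le
    refine ⟨⌊L / (16 * x)⌋₊, ⌊n * L / (512 * x)⌋₊, q, _, ?_, hq0, hq1.le, hqrel, ?_,
      Or.inl (mul_div_cancel₀ _ two_ne_zero).le, ?_, ?_⟩
    · have h1 : L / (16 * x) ≤ R * Λ := by
        calc L / (16 * x) ≤ L * x⁻¹ := by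
              rw [← div_eq_mul_inv]
              gcongr
              linarith
          _ ≤ Λ * R := by gcongr
          _ = R * Λ := mul_comm _ _
      linarith
    · have := accuracy_of_large hn0 hx hcase hρ0 (by
        rw [hρ]
        have : κ ≠ 0 := by linarith
        field_simp
        linarith) hε0 hL hKle hqexp hqlow
      linarith
    · exact fun i => card_bound_of_large hn0 hx hcase hKlt hTle (card_passes_le hn0 i _ _)
    · rw [max_eq_right hL0.le]
      refine le_trans ?_ hTlt
      have hn2 : (n : ℝ) ≤ √(n * (κ - 1)) * L / 128 := by
        have := mul_le_mul_of_nonneg_left hcase (Real.sqrt_nonneg (n * (κ - 1)))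
        linarith
      have hM : n * L / (512 * x) = √(n * (κ - 1)) * L / 512 := by
        nth_rewrite 1 [← hS]
        field_simp
      rw [hM]
      linarith
  · rw [not_le] at hcase
    refine ⟨0, n / 2, q, 1 / 2, ?_, hq0, hq1.le, hqrel, hε, Or.inr ⟨rfl, by norm_num⟩, ?_, ?_⟩
    · push_cast
      nlinarith
    · intro i
      have h1 := card_passes_one_le i (n / 2)
      rw [zero_add, pow_one]
      omega
    · have h1 : √(n * (κ - 1)) * max 0 L ≤ 128 * n := by
        calc √(n * (κ - 1)) * max 0 L ≤ √(n * (κ - 1)) * (128 * x) :=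
              mul_le_mul_of_nonneg_left (max_le (by linarith) hcase.le) (Real.sqrt_nonneg _)
          _ = 128 * (√(n * (κ - 1)) * x) := by ring
          _ = 128 * n := by rw [hS]
      have h2 : (n : ℝ) ≤ 2 * ((n / 2 : ℕ) + 1) := by
        have : n ≤ 2 * (n / 2 + 1) := by omega
        exact_mod_cast this
      linarith

/-! ### The lower bound -/

theorem theorem2 :
    ∃ c > (0 : ℝ), ∃ c₁ > (0 : ℝ), ∃ C > (0 : ℝ),
      ∀ (n : ℕ) (lam mu ε : ℝ), 1 < n → 0 < lam → lam < mu → 0 < ε → ε < c →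
        ∃ d : ℕ,
          (d : ℝ) ≤ C * (1 + √(mu / (lam * n))) * Real.log (n * (mu / lam) / ε) ∧
          ∀ (p : ℕ∞) (Ω : Type*) [MeasurableSpace Ω] (P : Measure Ω) [IsProbabilityMeasure P]
            (alg : Algorithm Ω n d p),
            alg.IsMeasurable (quadraticInstances n d lam mu) →
            alg.IsLinearAlgebraic P (quadraticInstances n d lam mu) →
            alg.IsOblivious P (quadraticInstances n d lam mu) →
            ∃ f ∈ quadraticInstances n d lam mu, ∃ wstar : Vec d,
              (∀ w, meanObjective f wstar ≤ meanObjective f w) ∧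
              ∀ T : ℕ, 1 ≤ T →
                ∫⁻ ω, ENNReal.ofReal (meanObjective f (alg.iterate f ω (T - 1)) - meanObjective f wstar) ∂P
                  ≤ ENNReal.ofReal (ε * (meanObjective f 0 - meanObjective f wstar)) →
                c₁ * (n + √(n * (mu / lam - 1))
                    * Real.log ((lam / mu) ^ (3 / 2 : ℝ) * √n / ε)) ≤ T ∧
                (2 * lam ≤ mu →
                  c₁ * (n + √(n * mu / lam)
                    * Real.log ((lam / mu) ^ (3 / 2 : ℝ) * √n / ε)) ≤ T) := by
  refine ⟨1 / 2, by norm_num, 1 / 2000, by norm_num, 1, one_pos, ?_⟩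
  intro n lam mu ε hn hlam hmu hε0 hε
  obtain ⟨K, T₀, q, δ, hd, hq0, hq1, hq, hεδ, hδ, hcard, hT₀⟩ :=
    exists_chain_parameters hn hlam hmu hε0 hε
  refine ⟨K + 1, by rw [one_mul]; exact_mod_cast hd, ?_⟩
  intro p Ω _ P _ alg hmeas hlin hobl
  obtain ⟨f, hf, wstar, hmin, hhard⟩ := exists_hard_chain hn hlam hmu hq0 hq1 hq hεδ
    (hε0.trans hεδ) hδ (by convert hcard) alg hmeas hlin hobl
  refine ⟨f, hf, wstar, hmin, fun T hT hle => ?_⟩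
  -- The `T`-th iterate is the query number `T - 1`.
  have hlt : T₀ < T - 1 := by
    by_contra! h
    exact absurd hle (not_le.2 (hhard _ h))
  have hTT : (T₀ : ℝ) + 1 ≤ T := by
    have : T₀ + 1 ≤ T := by omega
    exact_mod_cast this
  have hn' : (0 : ℝ) < n := by positivity
  set L := Real.log ((lam / mu) ^ (3 / 2 : ℝ) * √n / ε)
  have hmax := mul_le_mul_of_nonneg_left (le_max_right 0 L) (Real.sqrt_nonneg (n * (mu / lam - 1)))
  have hmax0 := mul_nonneg (Real.sqrt_nonneg (n * (mu / lam - 1))) (le_max_left 0 L)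
  refine ⟨by linarith, fun h2 => ?_⟩
  have hκ : 2 ≤ mu / lam := (le_div_iff₀ hlam).2 h2
  have hsqrt : √(n * mu / lam) ≤ 2 * √(n * (mu / lam - 1)) := by
    rw [mul_div_assoc, Real.sqrt_le_left (by positivity), mul_pow,
      Real.sq_sqrt (mul_nonneg hn'.le (by linarith))]
    nlinarith
  have h3 : √(n * mu / lam) * L ≤ 2 * √(n * (mu / lam - 1)) * max 0 L :=
    (mul_le_mul_of_nonneg_left (le_max_right 0 L) (Real.sqrt_nonneg _)).trans
      (mul_le_mul_of_nonneg_right hsqrt (le_max_left 0 L))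
  linarith
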